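/- Let $G$ be a group. A \emph{character} of $G$ is a function $\psi\colon G\to\mathbb{C}$ of positive type which is constant on conjugacy classes and satisfies $\psi(1)=1$. The completion $\ell^\psi(G)$ of $\mathbb{C}[G]$ with respect to the semi-definite inner product $\langle g,h\rangle_\psi=\psi(h^{-1}g)$ is a Hilbert space with commuting isometric left and right actions of $G$. For a closed $G$-invariant subspace $K\subseteq \ell^\psi(G)^n$ put $\dim_\psi K=\sum_{i=1}^n\langle P e_i,e_i\rangle$, where $P$ is the orthogonal projection onto $K$ and $e_i$ is the class of $1\in G$ in the $i$-th coordinate. Suppose that $G$ is finitely generated, let $t_1,\dots,t_n$ be a finite generating system, let $R$ be the kernel of the induced homomorphism from the free group on $n$ letters onto $G$, and let $$\ell^\psi(G)^{\oplus R}\xrightarrow{\partial_2}\ell^\psi(G)^n\xrightarrow{\partial_1}\ell^\psi(G)$$ be obtained by tensoring with $\ell^\psi(G)$ the initial segment $\mathbb{C}[G]^{\oplus R}\to\mathbb{C}[G]^n\to\mathbb{C}[G]$ of the free resolution of $\mathbb{C}$ associated with this presentation (so $\partial_1(x_i)_i=\sum_i x_i(t_i-1)$, and $\partial_2$ is given by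 the Fox derivatives of the relations). The first $\psi$-Betti number $b_1^\psi(G)$ is the $\psi$-dimension of $\ker\partial_1/\overline{\operatorname{im}\partial_2}$, identified with the orthogonal complement of $\operatorname{im}\partial_2$ in $\ker\partial_1$; it does not depend on the choice of the generating system. A subgroup $K\le G$ is \emph{$\psi$-regular} if $\psi(k)=0$ for all $k\in K\setminus\{1\}$. A family $(s_i)_{i\in\mathcal I}$ in $G$ is a \emph{right-angled set of generators} if there are a finite connected graph $\Gamma$ with vertex set $\mathcal I$ and a surjective homomorphism $A_\Gamma\to G$ which maps the standard generators $\sigma_i$ of the right-angled Artin group $A_\Gamma=\langle \sigma_i\ (i\in\mathcal I)\mid \sigma_i\sigma_j=\sigma_j\sigma_i \text{ if } i,j \text{ are adjacent}\rangle$ to $s_i$, and every $s_i$ has infinite order in $G$. A group is \emph{right-angled} if it has such a set of generators. \textbf{Theorem.} Let $G$ be a right-angled group with right-angled set of generators $\{s_i\mid i\in\mathcal I\}$, and let $\psi$ be a character of $G$ such that the cyclic subgroup $\langle s_i\rangle$ is $\psi$-regular for every $i\in\mathcal I$. Then $b_1^\psi(G)=0$ (whichever finite generating system of $G$ is used to compute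 it). -/

import Mathlib

open scoped ComplexOrder ComplexConjugate

universe u v w

noncomputable section



/-! ### Characters of groups -/

/-- A character of a group `G`: a function `ψ : G → ℂ` of positive type (all finite matrices
`(ψ (gᵢ⁻¹ * gⱼ))` are positive semidefinite) which is constant on conjugacy classes and satisfies
`ψ 1 = 1`. -/
structure GroupCharacter (G : Type u) [Group G] where
  toFun : G → ℂ
  positiveType : (Matrix.of fun g h : G => toFun (g⁻¹ * h)).PosSemidef
  conj_invariant : ∀ g h : G, toFun (h * g * h⁻¹) = toFun g
  map_one : toFun 1 = 1

namespace GroupCharacter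

variable {G : Type u} [Group G]

instance : CoeFun (GroupCharacter G) (fun _ => G → ℂ) := ⟨GroupCharacter.toFun⟩

/-- A subgroup `K` is `ψ`-regular if the restriction of `ψ` to `K` is the regular character. -/
def IsRegularOn (ψ : GroupCharacter G) (K : Subgroup G) : Prop :=
  ∀ k ∈ K, k ≠ 1 → ψ k = 0

/-! ### The tracial Hilbert bimodule `ℓ^ψ(G)` -/

set_option linter.unusedVariables false in
/-- The group ring `ℂ[G]`, to be equipped with the semi-definite inner product given by `ψ`. -/
@[nolint unusedArguments]
def PreHilb (ψ : GroupCharacter G) : Type u := MonoidAlgebra ℂ G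

variable (ψ : GroupCharacter G)

instance : AddCommGroup ψ.PreHilb := inferInstanceAs (AddCommGroup (MonoidAlgebra ℂ G))
instance : Module ℂ ψ.PreHilb := inferInstanceAs (Module ℂ (MonoidAlgebra ℂ G))

/-- The identity map from the group ring to its copy carrying the inner product of `ψ`. -/
def toPre : MonoidAlgebra ℂ G ≃ₗ[ℂ] ψ.PreHilb := LinearEquiv.refl ℂ _

/-- The sesquilinear form on `ℂ[G]`, conjugate-linear in the first variable, in which the pair of
group elements `(g, h)` is sent to `ψ (g⁻¹ * h)`. -/
def form (a b : MonoidAlgebra ℂ G) : ℂ :=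
  a.coeff.sum fun g x => b.coeff.sum fun h y => conj x * ψ (g⁻¹ * h) * y

theorem conj_apply_inv (g : G) : conj (ψ g⁻¹) = ψ g := by
  have h := ψ.positiveType.1.apply 1 g
  simpa using h

/-- The semi-definite inner product on `ℂ[G]` given by `ψ`. -/
abbrev preCore : PreInnerProductSpace.Core ℂ ψ.PreHilb where
  inner a b := ψ.form (ψ.toPre.symm a) (ψ.toPre.symm b)
  conj_inner_symm a b := by
    unfold form
    simp only [Finsupp.sum, map_sum, map_mul, Complex.conj_conj]
    rw [Finset.sum_comm]
    refine Finset.sum_congr rfl fun g _ => Finset.sum_congr rfl fun h _ => ?_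
    have := ψ.conj_apply_inv (g⁻¹ * h)
    rw [mul_inv_rev, inv_inv] at this
    rw [this]; ring
  re_inner_nonneg a := by
    have h := ψ.positiveType.2 (ψ.toPre.symm a).coeff
    exact (Complex.le_def.1 h).1
  add_left a b c := by
    unfold form
    rw [map_add, MonoidAlgebra.coeff_add, Finsupp.sum_add_index']
    · intro g; simp
    · intro g x y; simp [add_mul, Finsupp.sum_add]
  smul_left a b r := by
    unfold form
    rw [map_smul, MonoidAlgebra.coeff_smul, Finsupp.sum_smul_index' (by intro g; simp),
      Finsupp.mul_sum]
    refine Finsupp.sum_congr fun g _ => ?_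
    rw [Finsupp.mul_sum]
    refine Finsupp.sum_congr fun h _ => ?_
    simp only [smul_eq_mul, map_mul]; ring

instance : SeminormedAddCommGroup ψ.PreHilb :=
  InnerProductSpace.Core.toSeminormedAddCommGroup (c := ψ.preCore)
instance : InnerProductSpace ℂ ψ.PreHilb := InnerProductSpace.ofCore ψ.preCore

theorem inner_def (a b : ψ.PreHilb) :
    inner ℂ a b = ψ.form (ψ.toPre.symm a) (ψ.toPre.symm b) := rfl

/-- The Hilbert space `ℓ^ψ(G)`: the (Hausdorff) completion of `ℂ[G]` with respect to the
semi-definite inner product given by `ψ`. -/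
abbrev Hilb : Type u := UniformSpace.Completion ψ.PreHilb

/-- The trace vector of `ℓ^ψ(G)`, that is, the class of `1 ∈ G`. -/
def traceVec : ψ.Hilb := ((ψ.toPre 1 : ψ.PreHilb) : ψ.Hilb)

theorem form_mul_single (g : G) (a b : MonoidAlgebra ℂ G) :
    ψ.form (a * MonoidAlgebra.single g 1) (b * MonoidAlgebra.single g 1) = ψ.form a b := by
  have key : ∀ c : MonoidAlgebra ℂ G,
      (c * MonoidAlgebra.single g 1).coeff = c.coeff.mapDomain (fun x => x * g) := by
    intro c
    ext x
    have hx : x = (x * g⁻¹) * g := by group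
    rw [MonoidAlgebra.coeff_mul_single_apply, mul_one, hx,
      Finsupp.mapDomain_apply (mul_left_injective g)]
    simp
  unfold form
  rw [key, key, Finsupp.sum_mapDomain_index_inj (mul_left_injective g)]
  refine Finsupp.sum_congr fun x _ => ?_
  rw [Finsupp.sum_mapDomain_index_inj (mul_left_injective g)]
  refine Finsupp.sum_congr fun y _ => ?_
  have h := ψ.conj_invariant (x⁻¹ * y) g⁻¹
  have e : (x * g)⁻¹ * (y * g) = g⁻¹ * (x⁻¹ * y) * g⁻¹⁻¹ := by group
  rw [e, h]

/-- Right translation by a group element on `ℂ[G]`. It is isometric as `ψ` is conjugation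
invariant. -/
def preRight (g : G) : ψ.PreHilb →ₗᵢ[ℂ] ψ.PreHilb :=
  LinearMap.isometryOfInner
    (ψ.toPre.toLinearMap ∘ₗ LinearMap.mulRight ℂ (MonoidAlgebra.single g (1 : ℂ)) ∘ₗ
      ψ.toPre.symm.toLinearMap)
    (fun _ _ => ψ.form_mul_single g _ _)

/-- The right action of the group ring on `ℓ^ψ(G)`: the bounded operator extending
`x ↦ x * a`, for `a ∈ ℂ[G]`. -/
def rightMul (a : MonoidAlgebra ℂ G) : ψ.Hilb →L[ℂ] ψ.Hilb :=
  a.coeff.sum fun g c => c • (ψ.preRight g).toContinuousLinearMap.completion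

/-! ### Dimension -/

variable {ι : Type w} [Fintype ι]

/-- The Hilbert space `ℓ^ψ(G)^ι`, with the `ℓ²` norm. -/
abbrev HilbPow (ι : Type w) [Fintype ι] : Type (max u w) := PiLp 2 fun _ : ι => ψ.Hilb

open Classical in
/-- The vector of `ℓ^ψ(G)^ι` which is the trace vector at `i` and zero elsewhere. -/
def basisVec (i : ι) : ψ.HilbPow ι := WithLp.toLp 2 (Pi.single i ψ.traceVec)

/-- The dimension `dim_ψ` of (the closure of) a `G`-invariant subspace `K` of `ℓ^ψ(G)^ι`: the von
Neumann trace `∑ i, ⟨P eᵢ, eᵢ⟩` of the orthogonal projection `P` onto the closure of `K`. -/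
def dim (K : Submodule ℂ (ψ.HilbPow ι)) : ℝ :=
  ∑ i, (inner ℂ (ψ.basisVec i) (K.topologicalClosure.starProjection (ψ.basisVec i))).re

/-! ### The first Betti number -/

open Classical in
/-- For a word `w` in letters `i^{±1}`, the element of `ℂ[G]^ι` given by the edge path with label
`w` which starts at `1` in the Cayley graph of `G` with respect to `t : ι → G`. Here the `i`-th
coordinate `g` stands for the edge from `g` to `g * t i`. -/
def pathChain (t : ι → G) : List (ι × Bool) → ι → MonoidAlgebra ℂ G
  | [] => 0
  | (i, true) :: l => Pi.single i 1 + MonoidAlgebra.single (t i) (1 : ℂ) • pathChain t l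
  | (i, false) :: l => MonoidAlgebra.single (t i)⁻¹ (1 : ℂ) • (pathChain t l - Pi.single i 1)

open Classical in
/-- The Fox derivatives of an element of the free group, as elements of `ℂ[G]`. -/
def foxChain (t : ι → G) (r : FreeGroup ι) : ι → MonoidAlgebra ℂ G :=
  pathChain t r.toWord

/-- The boundary map `∂₁ : ℓ^ψ(G)^ι → ℓ^ψ(G)`, `(xᵢ) ↦ ∑ i, xᵢ (tᵢ - 1)`. -/
def boundaryOne (t : ι → G) : ψ.HilbPow ι →L[ℂ] ψ.Hilb :=
  ∑ i, (ψ.rightMul (MonoidAlgebra.single (t i) 1 - 1)).comp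
    (PiLp.proj 2 (fun _ : ι => ψ.Hilb) i)

/-- The boundary map `∂₂` from the direct sum of copies of `ℓ^ψ(G)` over the subgroup of all
relations `r` between the `tᵢ`, given by `(x_r) ↦ (∑ r, x_r (∂r/∂i))ᵢ`. It is obtained by applying
`ℓ^ψ(G) ⊗_{ℂ[G]} -` to the free resolution of `ℂ` given by the presentation of `G`. -/
def boundaryTwo (t : ι → G) : ((FreeGroup.lift t).ker →₀ ψ.Hilb) →ₗ[ℂ] ψ.HilbPow ι :=
  Finsupp.lsum ℂ fun r =>
    (WithLp.linearEquiv 2 ℂ (ι → ψ.Hilb)).symm.toLinearMap ∘ₗ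
      LinearMap.pi fun i => (ψ.rightMul (foxChain t r i)).toLinearMap

/-- The first `ψ`-Betti number of `G`, computed with a finite generating system `t : ι → G`: the
`ψ`-dimension of the reduced homology `ker ∂₁ / closure (im ∂₂)`, realised as the orthogonal
complement of `im ∂₂` in `ker ∂₁`. -/
def bettiOne (t : ι → G) : ℝ :=
  ψ.dim (LinearMap.ker (ψ.boundaryOne t).toLinearMap ⊓ (LinearMap.range (ψ.boundaryTwo t))ᗮ)

end GroupCharacter

/-! ### Right-angled groups -/

/-- The right-angled Artin group of a graph `Γ`: one generator for each vertex, and generators of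
adjacent vertices commute. -/
abbrev RightAngledArtin {I : Type v} (Γ : SimpleGraph I) : Type v :=
  PresentedGroup {r : FreeGroup I | ∃ i j, Γ.Adj i j ∧
    r = FreeGroup.of i * FreeGroup.of j * (FreeGroup.of i)⁻¹ * (FreeGroup.of j)⁻¹}

/-- `s : I → G` is a right-angled system of generators of `G`: for some finite connected graph on
`I`, the group `G` is a quotient of the right-angled Artin group with the standard generators
mapping to the `s i`, and every `s i` has infinite order. -/
def IsRightAngledGenerating {G : Type u} [Group G] {I : Type v} (s : I → G) : Prop :=
  Finite I ∧ ∃ Γ : SimpleGraph I, Γ.Connected ∧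
    ∃ π : RightAngledArtin Γ →* G, Function.Surjective π ∧
      (∀ i, π (PresentedGroup.of i) = s i) ∧ ∀ i, ¬ IsOfFinOrder (s i)

end

/-! Let n be the number of generators `t`. The adjoints of the Fox operators evaluate a vector of
`ℓ^ψ(G)^n`, read as prescribed values on the generators, at words. The orthogonal complement Z of im
∂₂ then consists of the vectors that define 1-cocycles of G with values in `ℓ^ψ(G)`. The Betti
number is the dimension of ker ∂₁ ∩ Z.

Right translation by `s i` fixes no nonzero vector, by Bessel's inequality (`eq_zero_of_right_eq`).
If a cocycle vanishes at `s i` and `s j` commutes with `s i`, its value at `s j` is fixed by `s i`,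
hence zero (`eval_eq_zero_of_commute`). As the graph is connected, a cocycle is determined by its
value at a single `s i₀`. So Z embeds equivariantly into `ℓ^ψ(G)`, which forces dim Zᗮ ≥ n - 1. Also
dim ker ∂₁ = n - 1, since ∂₁ has dense range. As Zᗮ ⊆ ker ∂₁, nothing is left for ker ∂₁ ∩ Z.

Both dimension statements come from the index formula `dim_ker`. Its proof avoids polar
decomposition: projections onto kernels are limits of Cesàro averages of powers of 1 - cB†B, and the
trace property compares these powers with those of 1 - cBB†. -/

open Filter Topology ContinuousLinearMap

/-! ### Equivariant bounded operators -/

/-- `A` intertwines the families of operators `U` and `V`. -/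
def Intertwines {G E F : Type*} [NormedAddCommGroup E] [NormedSpace ℂ E] [NormedAddCommGroup F]
    [NormedSpace ℂ F] (U : G → E →L[ℂ] E) (V : G → F →L[ℂ] F) (A : E →L[ℂ] F) : Prop :=
  ∀ g x, A (U g x) = V g (A x)

namespace Intertwines

variable {G E F H : Type*} [NormedAddCommGroup E] [InnerProductSpace ℂ E]
  [NormedAddCommGroup F] [InnerProductSpace ℂ F]
  [NormedAddCommGroup H] [InnerProductSpace ℂ H]
  {U : G → E →L[ℂ] E} {V : G → F →L[ℂ] F} {W : G → H →L[ℂ] H}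

theorem comp {B : F →L[ℂ] H} {A : E →L[ℂ] F} (hB : Intertwines V W B) (hA : Intertwines U V A) :
    Intertwines U W (B ∘L A) := fun g x => by rw [comp_apply, hA, hB, comp_apply]

theorem one_sub_smul {A : E →L[ℂ] E} (hA : Intertwines U U A) (c : ℂ) :
    Intertwines U U (1 - c • A) := fun g x => by simp [hA g x]

theorem pow {A : E →L[ℂ] E} (hA : Intertwines U U A) (n : ℕ) : Intertwines U U (A ^ n) := by
  induction n with
  | zero => intro g x; simp
  | succ n ih => rw [pow_succ]; exact ih.comp hA

theorem sum {κ : Type*} {S : Finset κ} {A : κ → E →L[ℂ] F} (hA : ∀ i ∈ S, Intertwines U V (A i)) :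
    Intertwines U V (∑ i ∈ S, A i) := fun g x => by
  simp only [sum_apply, map_sum]
  exact Finset.sum_congr rfl fun i hi => hA i hi g x

theorem adjoint [Group G] [CompleteSpace E] [CompleteSpace F]
    (hU : ∀ g, ContinuousLinearMap.adjoint (U g) = U g⁻¹)
    (hV : ∀ g, ContinuousLinearMap.adjoint (V g) = V g⁻¹) {A : E →L[ℂ] F}
    (hA : Intertwines U V A) : Intertwines V U (ContinuousLinearMap.adjoint A) := fun g x => by
  refine ext_inner_left ℂ fun y => ?_
  have hV' := hV g⁻¹
  have hU' := hU g⁻¹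
  rw [inv_inv] at hV' hU'
  rw [adjoint_inner_right, ← hV', adjoint_inner_right, ← hA, ← hU', adjoint_inner_right,
    adjoint_inner_right]

end Intertwines

/-! ### Group elements as a total set of vectors in `ℓ^ψ(G)` -/

namespace GroupCharacter

variable {G : Type u} [Group G] (ψ : GroupCharacter G)

/-- The class of a group element in `ℓ^ψ(G)`. -/
noncomputable def vec (g : G) : ψ.Hilb := ((ψ.toPre (MonoidAlgebra.single g 1) : ψ.PreHilb) : ψ.Hilb)

theorem vec_one : ψ.vec 1 = ψ.traceVec := rfl

theorem form_single (g h : G) (x y : ℂ) :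
    ψ.form (MonoidAlgebra.single g x) (MonoidAlgebra.single h y) = conj x * ψ (g⁻¹ * h) * y := by
  simp [form]

theorem inner_single (g h : G) (x y : ℂ) :
    inner ℂ (ψ.toPre (MonoidAlgebra.single g x)) (ψ.toPre (MonoidAlgebra.single h y)) =
      conj x * ψ (g⁻¹ * h) * y := by
  rw [inner_def, LinearEquiv.symm_apply_apply, LinearEquiv.symm_apply_apply, form_single]

theorem inner_vec (g h : G) : inner ℂ (ψ.vec g) (ψ.vec h) = ψ (g⁻¹ * h) := by
  simp [vec, UniformSpace.Completion.inner_coe, inner_single]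

theorem coe_toPre_single (g : G) (c : ℂ) :
    ((ψ.toPre (MonoidAlgebra.single g c) : ψ.PreHilb) : ψ.Hilb) = c • ψ.vec g := by
  rw [vec, ← UniformSpace.Completion.coe_smul, ← map_smul, MonoidAlgebra.smul_single]
  simp

theorem induction_closed {p : ψ.Hilb → Prop} (hc : IsClosed {x | p x}) (h0 : p 0)
    (hadd : ∀ x y, p x → p y → p (x + y)) (hvec : ∀ (c : ℂ) g, p (c • ψ.vec g)) (x : ψ.Hilb) :
    p x := by
  refine UniformSpace.Completion.induction_on x hc fun a => ?_
  obtain ⟨a, rfl⟩ := ψ.toPre.surjective a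
  induction a using MonoidAlgebra.induction_linear with
  | zero => rw [map_zero, UniformSpace.Completion.coe_zero]; exact h0
  | add a b ha hb => simpa [UniformSpace.Completion.coe_add] using hadd _ _ ha hb
  | single g c => rw [coe_toPre_single]; exact hvec c g

theorem hilb_ext {E : Type*} [NormedAddCommGroup E] [NormedSpace ℂ E] {A B : ψ.Hilb →L[ℂ] E}
    (h : ∀ g, A (ψ.vec g) = B (ψ.vec g)) : A = B := by
  ext x
  refine ψ.induction_closed (p := fun x => A x = B x)
    (isClosed_eq A.continuous B.continuous) (by simp) ?_ ?_ x
  · intro x y hx hy; simp [hx, hy]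
  · intro c g; simp [h]

/-- The classes of group elements span a dense subspace. With `hilb_ext`, this reduces operator
identities to identities between values of `ψ`. -/
theorem eq_of_inner_vec {x y : ψ.Hilb} (h : ∀ g, inner ℂ (ψ.vec g) x = inner ℂ (ψ.vec g) y) :
    x = y := by
  have h' : innerSL ℂ x = innerSL ℂ y := by
    refine ψ.hilb_ext fun g => ?_
    rw [innerSL_apply_apply, innerSL_apply_apply, ← inner_conj_symm, h, inner_conj_symm]
  exact ext_inner_right ℂ fun z => congrArg (fun f => f z) h'

/-! ### Translations -/

theorem form_eq_inner (a b : MonoidAlgebra ℂ G) :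
    ψ.form a b = inner ℂ (ψ.toPre a) (ψ.toPre b) := by
  rw [inner_def, LinearEquiv.symm_apply_apply, LinearEquiv.symm_apply_apply]

theorem form_single_mul (g : G) (a b : MonoidAlgebra ℂ G) :
    ψ.form (MonoidAlgebra.single g 1 * a) (MonoidAlgebra.single g 1 * b) = ψ.form a b := by
  rw [form_eq_inner, form_eq_inner]
  induction a using MonoidAlgebra.induction_linear with
  | zero => simp
  | add a a' ha hb => simp only [mul_add, map_add, inner_add_left, ha, hb]
  | single x c =>
    induction b using MonoidAlgebra.induction_linear with
    | zero => simp
    | add a a' ha hb => simp only [mul_add, map_add, inner_add_right, ha, hb]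
    | single y d => simp [MonoidAlgebra.single_mul_single, inner_single, mul_assoc]

/-- Left translation by a group element on `ℂ[G]`. -/
noncomputable def preLeft (g : G) : ψ.PreHilb →ₗᵢ[ℂ] ψ.PreHilb :=
  LinearMap.isometryOfInner
    (ψ.toPre.toLinearMap ∘ₗ LinearMap.mulLeft ℂ (MonoidAlgebra.single g (1 : ℂ)) ∘ₗ
      ψ.toPre.symm.toLinearMap)
    (fun _ _ => ψ.form_single_mul g _ _)

/-- Left translation by a group element on `ℓ^ψ(G)`. -/
noncomputable def left (g : G) : ψ.Hilb →L[ℂ] ψ.Hilb :=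
  (ψ.preLeft g).toContinuousLinearMap.completion

/-- Right translation by a group element on `ℓ^ψ(G)`. -/
noncomputable def right (g : G) : ψ.Hilb →L[ℂ] ψ.Hilb :=
  (ψ.preRight g).toContinuousLinearMap.completion

@[simp] theorem left_vec (g h : G) : ψ.left g (ψ.vec h) = ψ.vec (g * h) := by
  rw [left, vec, ContinuousLinearMap.completion_apply_coe]
  change ((ψ.toPre (MonoidAlgebra.single g 1 * MonoidAlgebra.single h 1) : ψ.PreHilb) : ψ.Hilb) = _
  simp [vec, MonoidAlgebra.single_mul_single]

@[simp] theorem right_vec (g h : G) : ψ.right g (ψ.vec h) = ψ.vec (h * g) := by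
  rw [right, vec, ContinuousLinearMap.completion_apply_coe]
  change ((ψ.toPre (MonoidAlgebra.single h 1 * MonoidAlgebra.single g 1) : ψ.PreHilb) : ψ.Hilb) = _
  simp [vec, MonoidAlgebra.single_mul_single]

theorem adjoint_left (g : G) : adjoint (ψ.left g) = ψ.left g⁻¹ := by
  refine ψ.hilb_ext fun h => ψ.eq_of_inner_vec fun k => ?_
  simp [adjoint_inner_right, inner_vec, mul_assoc]

theorem adjoint_right (g : G) : adjoint (ψ.right g) = ψ.right g⁻¹ := by
  refine ψ.hilb_ext fun h => ψ.eq_of_inner_vec fun k => ?_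
  have := ψ.conj_invariant (k⁻¹ * h * g⁻¹) g⁻¹
  simp only [adjoint_inner_right, inner_vec, right_vec]
  rw [← mul_assoc, ← this]
  congr 1; group

theorem right_mul (g h : G) : ψ.right (g * h) = ψ.right h ∘L ψ.right g :=
  ψ.hilb_ext fun k => by simp [mul_assoc]

@[simp] theorem right_one : ψ.right 1 = ContinuousLinearMap.id ℂ _ :=
  ψ.hilb_ext fun k => by simp

theorem left_comp_right (g h : G) : ψ.left g ∘L ψ.right h = ψ.right h ∘L ψ.left g :=
  ψ.hilb_ext fun k => by simp [mul_assoc]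

/-! ### The right action of the group ring -/

theorem rightMul_zero : ψ.rightMul 0 = 0 := by simp [rightMul]

theorem rightMul_single (g : G) (c : ℂ) : ψ.rightMul (MonoidAlgebra.single g c) = c • ψ.right g := by
  simp [rightMul, right]

theorem rightMul_add (a b : MonoidAlgebra ℂ G) :
    ψ.rightMul (a + b) = ψ.rightMul a + ψ.rightMul b := by
  unfold rightMul
  rw [MonoidAlgebra.coeff_add, Finsupp.sum_add_index' (by simp) (by simp [add_smul])]

theorem rightMul_sub (a b : MonoidAlgebra ℂ G) :
    ψ.rightMul (a - b) = ψ.rightMul a - ψ.rightMul b := by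
  rw [eq_sub_iff_add_eq, ← rightMul_add, sub_add_cancel]

theorem rightMul_one : ψ.rightMul 1 = ContinuousLinearMap.id ℂ _ := by
  rw [MonoidAlgebra.one_def, rightMul_single, one_smul, right_one]

theorem rightMul_single_mul (g : G) (a : MonoidAlgebra ℂ G) :
    ψ.rightMul (MonoidAlgebra.single g 1 * a) = ψ.rightMul a ∘L ψ.right g := by
  induction a using MonoidAlgebra.induction_linear with
  | zero => simp [rightMul_zero]
  | add a b ha hb => rw [mul_add, rightMul_add, ha, hb, rightMul_add, add_comp]
  | single h c =>
    rw [MonoidAlgebra.single_mul_single, rightMul_single, rightMul_single, right_mul, one_mul,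
      smul_comp]

theorem left_comp_rightMul (g : G) (a : MonoidAlgebra ℂ G) :
    ψ.left g ∘L ψ.rightMul a = ψ.rightMul a ∘L ψ.left g := by
  induction a using MonoidAlgebra.induction_linear with
  | zero => simp [rightMul_zero]
  | add a b ha hb => rw [rightMul_add, comp_add, ha, hb, add_comp]
  | single h c => rw [rightMul_single, comp_smul, left_comp_right, smul_comp]

/-- A vector fixed by right translation by an element generating a regular infinite cyclic
subgroup is zero. -/
theorem eq_zero_of_right_eq {s : G} (hs : ¬ IsOfFinOrder s)
    (hψ : ψ.IsRegularOn (Subgroup.zpowers s)) {y : ψ.Hilb} (hy : ψ.right s y = y) : y = 0 := by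
  refine ψ.eq_of_inner_vec fun g => ?_
  rw [inner_zero_right]
  have hinj : Function.Injective fun n : ℕ => s ^ n := injective_pow_iff_not_isOfFinOrder.2 hs
  have hpow : ∀ n : ℕ, ψ.right (s ^ n) y = y := by
    intro n
    induction n with
    | zero => simp
    | succ n ih => rw [pow_succ, right_mul, comp_apply, ih, hy]
  -- Regularity makes the translates of `g` by powers of `s⁻¹` orthonormal. A fixed `y` has the same
  -- coefficient along all of them, so by Bessel's inequality this coefficient is zero.
  have horth : Orthonormal ℂ fun n : ℕ => ψ.vec (g * (s ^ n)⁻¹) := by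
    rw [orthonormal_iff_ite]
    intro n m
    rw [inner_vec]
    have e : (g * (s ^ n)⁻¹)⁻¹ * (g * (s ^ m)⁻¹) = s ^ n * (s ^ m)⁻¹ := by group
    rw [e]
    split_ifs with h
    · rw [h, mul_inv_cancel, ψ.map_one]
    · refine hψ _ (Subgroup.mul_mem _ ?_ (Subgroup.inv_mem _ ?_)) ?_
      · exact Subgroup.npow_mem_zpowers s n
      · exact Subgroup.npow_mem_zpowers s m
      · intro h'; exact h (hinj (mul_inv_eq_one.1 h'))
  have hsum := horth.inner_products_summable (x := y)
  have hc : ∀ n : ℕ, inner ℂ (ψ.vec (g * (s ^ n)⁻¹)) y = inner ℂ (ψ.vec g) y := by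
    intro n
    rw [← right_vec, ← adjoint_right, adjoint_inner_left, hpow]
  simp only [hc] at hsum
  have := (summable_const_iff _).1 hsum
  simpa using this

/-! ### The trace -/

/-- The conjugate-linear involution of `ℂ[G]` inverting group elements. -/
noncomputable def preStar : ψ.PreHilb →+ ψ.PreHilb :=
  ψ.toPre.toAddEquiv.toAddMonoidHom.comp <|
    AddMonoidHom.comp (MonoidAlgebra.liftNC
      ((MonoidAlgebra.singleAddHom (1 : G)).comp (starRingEnd ℂ : ℂ →+ ℂ))
      fun g => MonoidAlgebra.single g⁻¹ (1 : ℂ)) <|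
    ψ.toPre.symm.toAddEquiv.toAddMonoidHom

theorem preStar_single (g : G) (c : ℂ) :
    ψ.preStar (ψ.toPre (MonoidAlgebra.single g c)) =
      ψ.toPre (MonoidAlgebra.single g⁻¹ (conj c)) := by
  simp [preStar, MonoidAlgebra.single_mul_single]

/-- Conjugation invariance enters here, as ψ(xy⁻¹) = ψ(y⁻¹x). -/
theorem inner_preStar (a b : ψ.PreHilb) :
    inner ℂ (ψ.preStar a) (ψ.preStar b) = inner ℂ b a := by
  obtain ⟨a, rfl⟩ := ψ.toPre.surjective a
  obtain ⟨b, rfl⟩ := ψ.toPre.surjective b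
  induction a using MonoidAlgebra.induction_linear with
  | zero => simp
  | add a a' ha hb => simp only [map_add, inner_add_left, inner_add_right, ha, hb]
  | single x c =>
    induction b using MonoidAlgebra.induction_linear with
    | zero => simp
    | add a a' ha hb => simp only [map_add, inner_add_left, inner_add_right, ha, hb]
    | single y d =>
      have := ψ.conj_invariant (y⁻¹ * x) x
      have e : x * (y⁻¹ * x) * x⁻¹ = x * y⁻¹ := by group
      rw [e] at this
      simp only [preStar_single, inner_single, inv_inv, Complex.conj_conj, this]
      ring

theorem isometry_preStar : Isometry ψ.preStar := by
  refine AddMonoidHomClass.isometry_of_norm _ fun a => ?_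
  rw [@norm_eq_sqrt_re_inner ℂ, @norm_eq_sqrt_re_inner ℂ, inner_preStar]

/-- The antiunitary involution of `ℓ^ψ(G)` inverting group elements. -/
noncomputable def antiInv : ψ.Hilb → ψ.Hilb := UniformSpace.Completion.map ψ.preStar

theorem continuous_antiInv : Continuous ψ.antiInv := UniformSpace.Completion.continuous_map

theorem antiInv_vec (g : G) : ψ.antiInv (ψ.vec g) = ψ.vec g⁻¹ := by
  rw [antiInv, vec, UniformSpace.Completion.map_coe ψ.isometry_preStar.uniformContinuous,
    preStar_single, _root_.map_one, vec]

theorem inner_antiInv (x y : ψ.Hilb) : inner ℂ (ψ.antiInv x) (ψ.antiInv y) = inner ℂ y x := by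
  refine UniformSpace.Completion.induction_on₂ x y (isClosed_eq ?_ ?_) fun a b => ?_
  · exact (ψ.continuous_antiInv.comp continuous_fst).inner (ψ.continuous_antiInv.comp continuous_snd)
  · exact continuous_snd.inner continuous_fst
  · rw [antiInv, UniformSpace.Completion.map_coe ψ.isometry_preStar.uniformContinuous,
      UniformSpace.Completion.map_coe ψ.isometry_preStar.uniformContinuous,
      UniformSpace.Completion.inner_coe, UniformSpace.Completion.inner_coe, inner_preStar]

variable {ψ}

/-- An equivariant A behaves like right multiplication by A1, so its adjoint is right multiplication
by (A1)*. Indeed ⟨g, A†1⟩ = ⟨g·A1, 1⟩ = ⟨A1, g⁻¹⟩. -/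
theorem adjoint_traceVec {A : ψ.Hilb →L[ℂ] ψ.Hilb} (hA : Intertwines ψ.left ψ.left A) :
    adjoint A ψ.traceVec = ψ.antiInv (A ψ.traceVec) := by
  refine ψ.eq_of_inner_vec fun g => ?_
  have e : ψ.vec g = ψ.antiInv (ψ.vec g⁻¹) := by rw [antiInv_vec, inv_inv]
  conv_rhs => rw [e, inner_antiInv]
  have h1 : ψ.vec g = ψ.left g (ψ.vec 1) := by simp
  rw [adjoint_inner_right, h1, hA, ← adjoint_inner_right, adjoint_left, ← vec_one,
    left_vec, mul_one]

/-- With J = `antiInv`, both sides are matrix coefficients of A1 and B1: ⟨1, AB1⟩ = ⟨JA1, B1⟩ =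
⟨JB1, A1⟩ = ⟨1, BA1⟩, the middle equality because J is an antiunitary involution. -/
theorem trace_comm {A B : ψ.Hilb →L[ℂ] ψ.Hilb} (hA : Intertwines ψ.left ψ.left A)
    (hB : Intertwines ψ.left ψ.left B) :
    inner ℂ ψ.traceVec (A (B ψ.traceVec)) = inner ℂ ψ.traceVec (B (A ψ.traceVec)) := by
  rw [← adjoint_inner_left A, adjoint_traceVec hA, ← adjoint_inner_left B (A ψ.traceVec),
    adjoint_traceVec hB]
  have h : ∀ x : ψ.Hilb, ψ.antiInv (ψ.antiInv x) = x := fun x => by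
    refine ψ.eq_of_inner_vec fun g => ?_
    have e : ψ.vec g = ψ.antiInv (ψ.antiInv (ψ.vec g)) := by simp [antiInv_vec]
    conv_lhs => rw [e, inner_antiInv, inner_antiInv]
  conv_lhs => rw [← h (B ψ.traceVec), inner_antiInv]

end GroupCharacter

/-! ### Kernels of operators and the mean ergodic theorem -/

section Ergodic

variable {E F : Type*} [NormedAddCommGroup E] [InnerProductSpace ℂ E] [CompleteSpace E]
  [NormedAddCommGroup F] [InnerProductSpace ℂ F] [CompleteSpace F]

/-- Expanding the square gives ‖x‖² - 2c‖Bx‖² + c²‖B†Bx‖², and the last term is at most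
c(c‖B‖²)‖Bx‖² ≤ 2c‖Bx‖². -/
theorem ContinuousLinearMap.norm_one_sub_smul_adjoint_comp_le (B : E →L[ℂ] F) {c : ℝ} (hc : 0 ≤ c)
    (hcB : c * ‖B‖ ^ 2 ≤ 2) : ‖(1 - (c : ℂ) • (adjoint B ∘L B) : E →L[ℂ] E)‖ ≤ 1 := by
  refine opNorm_le_bound _ zero_le_one fun x => ?_
  rw [one_mul]
  refine (sq_le_sq₀ (norm_nonneg _) (norm_nonneg _)).1 ?_
  have h1 : (1 - (c : ℂ) • (adjoint B ∘L B) : E →L[ℂ] E) x = x - (c : ℂ) • adjoint B (B x) := rfl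
  have h2 : ‖adjoint B (B x)‖ ≤ ‖B‖ * ‖B x‖ := by
    simpa using (adjoint B).le_opNorm (B x)
  have h3 : ‖adjoint B (B x)‖ ^ 2 ≤ ‖B‖ ^ 2 * ‖B x‖ ^ 2 := by
    rw [← mul_pow]; gcongr
  have h4 : RCLike.re (inner ℂ x ((c : ℂ) • adjoint B (B x))) = c * ‖B x‖ ^ 2 := by
    rw [inner_smul_right, adjoint_inner_right, inner_self_eq_norm_sq_to_K]
    norm_cast
    change ((c : ℂ) * ((‖B x‖ ^ 2 : ℝ) : ℂ)).re = _
    rw [Complex.re_ofReal_mul, Complex.ofReal_re]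
  rw [h1, @norm_sub_sq ℂ, h4, norm_smul, mul_pow, Complex.norm_real, Real.norm_of_nonneg hc]
  have h5 : c ^ 2 * ‖adjoint B (B x)‖ ^ 2 ≤ c * (2 * ‖B x‖ ^ 2) := by
    calc c ^ 2 * ‖adjoint B (B x)‖ ^ 2 ≤ c ^ 2 * (‖B‖ ^ 2 * ‖B x‖ ^ 2) := by gcongr
      _ = c * ((c * ‖B‖ ^ 2) * ‖B x‖ ^ 2) := by ring
      _ ≤ _ := by gcongr
  linarith

theorem ContinuousLinearMap.eqLocus_one_sub_smul_adjoint_comp (B : E →L[ℂ] F) {c : ℝ} (hc : c ≠ 0) :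
    (1 - (c : ℂ) • (adjoint B ∘L B) : E →L[ℂ] E).eqLocus (1 : E →L[ℂ] E) =
      LinearMap.ker B.toLinearMap := by
  ext x
  have h1 : (1 - (c : ℂ) • (adjoint B ∘L B) : E →L[ℂ] E) x = x - (c : ℂ) • adjoint B (B x) := rfl
  rw [LinearMap.mem_eqLocus, LinearMap.mem_ker]
  change (1 - (c : ℂ) • (adjoint B ∘L B) : E →L[ℂ] E) x = x ↔ B x = 0
  rw [h1, sub_eq_self, smul_eq_zero, or_iff_right (by exact_mod_cast hc)]
  refine ⟨fun h => ?_, fun h => by rw [h, map_zero]⟩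
  have : inner ℂ (B x) (B x) = 0 := by rw [← adjoint_inner_right, h, inner_zero_right]
  exact inner_self_eq_zero.1 this

/-- The Cesàro averages of the powers of `1 - c B† B` converge to the projection onto `ker B`. -/
theorem ContinuousLinearMap.tendsto_average_starProjection_ker (B : E →L[ℂ] F) {c : ℝ} (hc : 0 < c)
    (hcB : c * ‖B‖ ^ 2 ≤ 2) (x : E) :
    Tendsto (fun N : ℕ => (N : ℂ)⁻¹ • ∑ k ∈ Finset.range N,
      ((1 - (c : ℂ) • (adjoint B ∘L B) : E →L[ℂ] E) ^ k) x) atTop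
      (𝓝 ((LinearMap.ker B.toLinearMap).starProjection x)) := by
  have h := (1 - (c : ℂ) • (adjoint B ∘L B) : E →L[ℂ] E).tendsto_birkhoffAverage_orthogonalProjection
    (B.norm_one_sub_smul_adjoint_comp_le hc.le hcB) x
  have e : ∀ (U V : Submodule ℂ E) [U.HasOrthogonalProjection] [V.HasOrthogonalProjection], U = V →
      ∀ x, U.starProjection x = V.starProjection x := by rintro U V _ _ rfl x; rfl
  have e' := e _ _ (B.eqLocus_one_sub_smul_adjoint_comp hc.ne') x
  rw [Submodule.starProjection_apply] at e'
  rw [e'] at h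
  refine h.congr fun N => ?_
  simp [birkhoffAverage, birkhoffSum]

/-- A projection onto an invariant subspace commutes with a family of operators closed under
adjoints. -/
theorem Submodule.starProjection_comm_of_invariant (U : Submodule ℂ E) [U.HasOrthogonalProjection]
    (T : E →L[ℂ] E) (hT : ∀ x ∈ U, T x ∈ U) (hT' : ∀ x ∈ U, adjoint T x ∈ U) (x : E) :
    U.starProjection (T x) = T (U.starProjection x) := by
  refine Submodule.eq_starProjection_of_mem_of_inner_eq_zero (hT _ (U.starProjection_apply_mem x))
    fun w hw => ?_
  rw [← map_sub, ← adjoint_inner_right]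
  exact U.starProjection_inner_eq_zero x _ (hT' w hw)

end Ergodic

/-! ### Finite powers of `ℓ^ψ(G)`, their trace and the index formula -/

namespace GroupCharacter

variable {G : Type u} [Group G] (ψ : GroupCharacter G) {ι : Type w} [Fintype ι]

/-- The operator into `ℓ^ψ(G)^ι` with the given components. -/
noncomputable def opPi {E : Type*} [NormedAddCommGroup E] [NormedSpace ℂ E]
    (f : ι → E →L[ℂ] ψ.Hilb) : E →L[ℂ] ψ.HilbPow ι :=
  (PiLp.continuousLinearEquiv 2 ℂ (fun _ : ι => ψ.Hilb)).symm.toContinuousLinearMap ∘L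
    ContinuousLinearMap.pi f

@[simp] theorem opPi_apply {E : Type*} [NormedAddCommGroup E] [NormedSpace ℂ E]
    (f : ι → E →L[ℂ] ψ.Hilb) (x : E) (i : ι) : ψ.opPi f x i = f i x := rfl

/-- Diagonal left translation on `ℓ^ψ(G)^ι`. -/
noncomputable def leftPow (g : G) : ψ.HilbPow ι →L[ℂ] ψ.HilbPow ι :=
  ψ.opPi fun i => ψ.left g ∘L PiLp.proj 2 (fun _ : ι => ψ.Hilb) i

@[simp] theorem leftPow_apply (g : G) (x : ψ.HilbPow ι) (i : ι) :
    ψ.leftPow g x i = ψ.left g (x i) := rfl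

theorem adjoint_leftPow (g : G) : adjoint (ψ.leftPow (ι := ι) g) = ψ.leftPow g⁻¹ := by
  ext1 x
  refine ext_inner_left ℂ fun y => ?_
  rw [adjoint_inner_right, PiLp.inner_apply, PiLp.inner_apply]
  refine Finset.sum_congr rfl fun i _ => ?_
  rw [leftPow_apply, leftPow_apply, ← adjoint_inner_right, adjoint_left]

open Classical in
/-- The inclusion of the `i`-th coordinate. -/
noncomputable def incl (i : ι) : ψ.Hilb →L[ℂ] ψ.HilbPow ι :=
  ψ.opPi fun j => if j = i then ContinuousLinearMap.id ℂ _ else 0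

open Classical in
theorem incl_apply (i j : ι) (x : ψ.Hilb) : ψ.incl i x j = if j = i then x else 0 := by
  rw [incl, opPi_apply]; split_ifs <;> rfl

theorem incl_traceVec (i : ι) : ψ.incl i ψ.traceVec = ψ.basisVec i := by
  classical
  ext j
  rw [incl_apply, basisVec, PiLp.toLp_apply, Pi.single_apply]

theorem inner_incl (i : ι) (x : ψ.Hilb) (y : ψ.HilbPow ι) :
    inner ℂ (ψ.incl i x) y = inner ℂ x (y i) := by
  classical
  rw [PiLp.inner_apply, Finset.sum_eq_single i]
  · rw [incl_apply, if_pos rfl]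
  · intro j _ hj; rw [incl_apply, if_neg hj, inner_zero_left]
  · simp

theorem sum_incl (y : ψ.HilbPow ι) : ∑ i, ψ.incl i (y i) = y := by
  classical
  refine ext_inner_right ℂ fun z => ?_
  rw [sum_inner, PiLp.inner_apply]
  exact Finset.sum_congr rfl fun i _ => ψ.inner_incl i _ _

theorem inner_basisVec (i : ι) (y : ψ.HilbPow ι) :
    inner ℂ (ψ.basisVec i) y = inner ℂ ψ.traceVec (y i) := by
  rw [← incl_traceVec, inner_incl]

theorem inner_traceVec_self : inner ℂ ψ.traceVec ψ.traceVec = 1 := by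
  rw [← vec_one, inner_vec]; simp [ψ.map_one]

theorem intertwines_incl (i : ι) : Intertwines ψ.left ψ.leftPow (ψ.incl i) := fun g x => by
  classical
  ext j
  rw [leftPow_apply, incl_apply, incl_apply]
  split_ifs <;> simp

theorem intertwines_proj (i : ι) :
    Intertwines ψ.leftPow ψ.left (PiLp.proj 2 (fun _ : ι => ψ.Hilb) i) := fun _ _ => rfl

theorem intertwines_rightMul (a : MonoidAlgebra ℂ G) : Intertwines ψ.left ψ.left (ψ.rightMul a) :=
  fun g x => (congrArg (fun f => f x) (ψ.left_comp_rightMul g a)).symm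

theorem intertwines_opPi {E : Type*} [NormedAddCommGroup E] [InnerProductSpace ℂ E]
    {U : G → E →L[ℂ] E} {f : ι → E →L[ℂ] ψ.Hilb} (hf : ∀ i, Intertwines U ψ.left (f i)) :
    Intertwines U ψ.leftPow (ψ.opPi f) := fun g x => by
  ext i; exact hf i g x

variable {ψ}

/-- Apply `trace_comm` to the i-th component of C and the restriction of B to the i-th summand, then
sum over i. -/
theorem trace_comp_comm {B : ψ.HilbPow ι →L[ℂ] ψ.Hilb} {C : ψ.Hilb →L[ℂ] ψ.HilbPow ι}
    (hB : Intertwines ψ.leftPow ψ.left B) (hC : Intertwines ψ.left ψ.leftPow C) :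
    ∑ i, inner ℂ (ψ.basisVec i) (C (B (ψ.basisVec i))) =
      inner ℂ ψ.traceVec (B (C ψ.traceVec)) := by
  conv_rhs => rw [← ψ.sum_incl (C ψ.traceVec), map_sum, inner_sum]
  refine Finset.sum_congr rfl fun i _ => ?_
  have := trace_comm ((ψ.intertwines_proj i).comp hC) (hB.comp (ψ.intertwines_incl i))
  rw [inner_basisVec, ← incl_traceVec]
  exact this

/-- Passing from k to k + 1 subtracts c tr(fᵏB†B) from the first trace and c tr(f'ᵏBB†) from the
second. Since Bfᵏ = f'ᵏB, the trace property makes these equal, so the difference keeps its value at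
k = 0. -/
theorem trace_pow_sub (B : ψ.HilbPow ι →L[ℂ] ψ.Hilb) (hB : Intertwines ψ.leftPow ψ.left B) (c : ℂ)
    (k : ℕ) :
    (∑ i, inner ℂ (ψ.basisVec i)
      (((1 - c • (adjoint B ∘L B) : ψ.HilbPow ι →L[ℂ] ψ.HilbPow ι) ^ k) (ψ.basisVec i))) -
      inner ℂ ψ.traceVec (((1 - c • (B ∘L adjoint B) : ψ.Hilb →L[ℂ] ψ.Hilb) ^ k) ψ.traceVec) =
    Fintype.card ι - 1 := by
  have hB' : Intertwines ψ.left ψ.leftPow (adjoint B) := hB.adjoint ψ.adjoint_leftPow ψ.adjoint_left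
  set f : ψ.HilbPow ι →L[ℂ] ψ.HilbPow ι := 1 - c • (adjoint B ∘L B) with hf
  set f' : ψ.Hilb →L[ℂ] ψ.Hilb := 1 - c • (B ∘L adjoint B) with hf'
  have hfi : Intertwines ψ.leftPow ψ.leftPow f := (hB'.comp hB).one_sub_smul c
  have hfx : ∀ x, f x = x - c • adjoint B (B x) := fun x => rfl
  have hfx' : ∀ x, f' x = x - c • B (adjoint B x) := fun x => rfl
  have hpow : ∀ (k : ℕ) x, (f ^ (k + 1)) x = (f ^ k) (f x) := fun k x => by rw [pow_succ]; rfl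
  have hpow' : ∀ (k : ℕ) x, (f' ^ (k + 1)) x = (f' ^ k) (f' x) := fun k x => by
    rw [pow_succ]; rfl
  have hcomm : ∀ k x, B ((f ^ k) x) = (f' ^ k) (B x) := by
    intro k
    induction k with
    | zero => intro x; rfl
    | succ k ih =>
      intro x
      rw [hpow, hpow', ih, hfx, hfx', map_sub, map_smul]
  induction k with
  | zero =>
    have hz : ∀ x, (f ^ 0) x = x := fun x => rfl
    have hz' : ∀ x, (f' ^ 0) x = x := fun x => rfl
    simp only [hz, hz', inner_traceVec_self]
    congr 1
    have : ∀ i : ι, inner ℂ (ψ.basisVec i) (ψ.basisVec i) = 1 := by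
      classical
      intro i
      rw [inner_basisVec, ← incl_traceVec, incl_apply, if_pos rfl, inner_traceVec_self]
    simp only [this, Finset.sum_const, Finset.card_univ, nsmul_eq_mul, mul_one]
  | succ k ih =>
    rw [← ih]
    have h1 := trace_comp_comm hB ((hfi.pow k).comp hB')
    simp only [comp_apply] at h1
    simp only [hpow, hpow', hfx, hfx', map_sub, map_smul, inner_sub_right,
      inner_smul_right, Finset.sum_sub_distrib, ← Finset.mul_sum]
    rw [h1, hcomm]
    ring

variable (ψ) in
theorem dim_eq_of_isClosed (U : Submodule ℂ (ψ.HilbPow ι)) (hU : IsClosed (U : Set (ψ.HilbPow ι)))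
    [U.HasOrthogonalProjection] :
    ψ.dim U = ∑ i, (inner ℂ (ψ.basisVec i) (U.starProjection (ψ.basisVec i))).re := by
  have e : ∀ (V : Submodule ℂ (ψ.HilbPow ι)) [V.HasOrthogonalProjection], U = V →
      ∀ x, V.starProjection x = U.starProjection x := by rintro V _ rfl x; rfl
  unfold dim
  simp only [e _ hU.submodule_topologicalClosure_eq.symm]

theorem tendsto_average_inner {E : Type*} [NormedAddCommGroup E] [InnerProductSpace ℂ E]
    {f : E →L[ℂ] E} {x y : E}
    (h : Tendsto (fun N : ℕ => (N : ℂ)⁻¹ • ∑ k ∈ Finset.range N, (f ^ k) x) atTop (𝓝 y)) :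
    Tendsto (fun N : ℕ => (N : ℂ)⁻¹ * ∑ k ∈ Finset.range N, inner ℂ x ((f ^ k) x)) atTop
      (𝓝 (inner ℂ x y)) := by
  refine (tendsto_const_nhds.inner h).congr fun N => ?_
  rw [inner_smul_right, inner_sum]

/-- The index formula: the kernel of an equivariant operator and the kernel of its adjoint have
dimensions which differ by the difference of the dimensions of the two spaces. -/
theorem dim_ker (B : ψ.HilbPow ι →L[ℂ] ψ.Hilb) (hB : Intertwines ψ.leftPow ψ.left B) :
    ψ.dim (LinearMap.ker B.toLinearMap) = Fintype.card ι - 1 +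
      (inner ℂ ψ.traceVec
        ((LinearMap.ker (adjoint B).toLinearMap).starProjection ψ.traceVec)).re := by
  rw [ψ.dim_eq_of_isClosed _ B.isClosed_ker]
  -- The summand 1 keeps `c` positive and well behaved when B = 0.
  set c : ℝ := (‖B‖ ^ 2 + 1)⁻¹
  have hc : 0 < c := by positivity
  have hcB : c * ‖B‖ ^ 2 ≤ 2 := by
    rw [inv_mul_le_iff₀ (by positivity)]; nlinarith [sq_nonneg ‖B‖]
  have hcB' : c * ‖adjoint B‖ ^ 2 ≤ 2 := by simpa using hcB
  have h1 := tendsto_finsetSum Finset.univ fun i (_ : i ∈ (Finset.univ : Finset ι)) =>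
    tendsto_average_inner (B.tendsto_average_starProjection_ker hc hcB (ψ.basisVec i))
  have h2 := tendsto_average_inner
    ((adjoint B).tendsto_average_starProjection_ker hc hcB' ψ.traceVec)
  rw [adjoint_adjoint] at h2
  have h3 := h1.sub h2
  -- The difference of the averages is constant except at N = 0, where both averages are zero.
  have h4 := tendsto_nhds_unique (h3.congr' (f₂ := fun _ => (Fintype.card ι - 1 : ℂ)) ?_)
    tendsto_const_nhds
  · have h5 := congrArg Complex.re h4
    simp only [Complex.sub_re, Complex.re_sum, Complex.natCast_re, Complex.one_re] at h5
    linarith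
  · filter_upwards [eventually_ne_atTop 0] with N hN
    rw [← Finset.mul_sum, Finset.sum_comm, ← mul_sub, ← Finset.sum_sub_distrib]
    simp only [trace_pow_sub B hB]
    rw [Finset.sum_const, Finset.card_range, nsmul_eq_mul, inv_mul_cancel_left₀]
    exact_mod_cast hN

end GroupCharacter

namespace GroupCharacter

variable {G : Type u} [Group G] (ψ : GroupCharacter G) {ι : Type w} [Fintype ι] (t : ι → G)

/-! ### Fox calculus -/

/-- The operator `ℓ^ψ(G) → ℓ^ψ(G)^ι` given by the edge path with a given label. -/
noncomputable def pathOp (L : List (ι × Bool)) : ψ.Hilb →L[ℂ] ψ.HilbPow ι :=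
  ψ.opPi fun i => ψ.rightMul (pathChain t L i)

open Classical in
theorem rightMul_piSingle (i j : ι) (x : ψ.Hilb) :
    ψ.rightMul ((Pi.single i 1 : ι → MonoidAlgebra ℂ G) j) x = ψ.incl i x j := by
  rw [incl_apply, Pi.single_apply]
  split_ifs
  · rw [rightMul_one]; rfl
  · rw [rightMul_zero]; rfl

theorem pathOp_nil : ψ.pathOp t [] = 0 := by
  ext x i
  change ψ.rightMul 0 x = 0
  rw [rightMul_zero]; rfl

theorem pathOp_cons_true (i : ι) (L : List (ι × Bool)) :
    ψ.pathOp t ((i, true) :: L) = ψ.incl i + ψ.pathOp t L ∘L ψ.right (t i) := by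
  classical
  ext x j
  have h : pathChain t ((i, true) :: L) j = (Pi.single i 1 : ι → MonoidAlgebra ℂ G) j +
      MonoidAlgebra.single (t i) 1 * pathChain t L j := by
    simp only [pathChain, Pi.add_apply, Pi.smul_apply, smul_eq_mul]
  rw [pathOp, opPi_apply, h, rightMul_add, rightMul_single_mul, add_apply, rightMul_piSingle]
  rfl

theorem pathOp_cons_false (i : ι) (L : List (ι × Bool)) :
    ψ.pathOp t ((i, false) :: L) = (ψ.pathOp t L - ψ.incl i) ∘L ψ.right (t i)⁻¹ := by
  classical
  ext x j
  have h : pathChain t ((i, false) :: L) j =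
      MonoidAlgebra.single (t i)⁻¹ 1 *
        (pathChain t L j - (Pi.single i 1 : ι → MonoidAlgebra ℂ G) j) := by
    simp only [pathChain, Pi.sub_apply, Pi.smul_apply, smul_eq_mul]
  rw [pathOp, opPi_apply, h, rightMul_single_mul, rightMul_sub, comp_apply, sub_apply,
    rightMul_piSingle]
  rfl

theorem right_inv_comp (g : G) : ψ.right g⁻¹ ∘L ψ.right g = ContinuousLinearMap.id ℂ _ := by
  rw [← right_mul, mul_inv_cancel, right_one]

theorem right_comp_inv (g : G) : ψ.right g ∘L ψ.right g⁻¹ = ContinuousLinearMap.id ℂ _ := by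
  rw [← right_mul, inv_mul_cancel, right_one]

/-- The path of the second word is translated to start at the endpoint of the first: the Fox product
rule. -/
theorem pathOp_append (L₁ L₂ : List (ι × Bool)) :
    ψ.pathOp t (L₁ ++ L₂) =
      ψ.pathOp t L₁ + ψ.pathOp t L₂ ∘L ψ.right (FreeGroup.lift t (FreeGroup.mk L₁)) := by
  induction L₁ with
  | nil => simp [pathOp_nil, FreeGroup.lift_mk]
  | cons a L ih =>
    obtain ⟨i, b⟩ := a
    rw [FreeGroup.lift_mk] at ih ⊢
    cases b
    · rw [List.cons_append, pathOp_cons_false, pathOp_cons_false, ih, List.map_cons,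
        List.prod_cons, right_mul, ← comp_assoc]
      simp only [cond_false]
      rw [← add_comp]
      congr 1
      abel
    · rw [List.cons_append, pathOp_cons_true, pathOp_cons_true, ih, List.map_cons,
        List.prod_cons, right_mul, ← comp_assoc, add_comp, add_assoc]
      rfl

/-- An edge followed by its inverse contributes zero and returns to its starting point. Hence the
chain of a word depends only on its class in the free group. -/
theorem pathOp_step {L₁ L₂ : List (ι × Bool)} (h : FreeGroup.Red.Step L₁ L₂) :
    ψ.pathOp t L₁ = ψ.pathOp t L₂ := by
  cases h with
  | @not L₁ L₂ x b =>
    rw [pathOp_append, pathOp_append]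
    congr 2
    cases b
    · rw [pathOp_cons_false, Bool.not_false, pathOp_cons_true, add_sub_cancel_left, comp_assoc,
        right_comp_inv, comp_id]
    · rw [pathOp_cons_true, Bool.not_true, pathOp_cons_false, comp_assoc, right_inv_comp, comp_id,
        add_sub_cancel]

theorem pathOp_red {L₁ L₂ : List (ι × Bool)} (h : FreeGroup.Red L₁ L₂) :
    ψ.pathOp t L₁ = ψ.pathOp t L₂ := by
  induction h with
  | refl => rfl
  | tail _ h ih => rw [ih, ψ.pathOp_step t h]

/-- The operator `ℓ^ψ(G) → ℓ^ψ(G)^ι` given by the Fox derivatives of a word. -/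
noncomputable def foxOp (w : FreeGroup ι) : ψ.Hilb →L[ℂ] ψ.HilbPow ι :=
  ψ.opPi fun i => ψ.rightMul (foxChain t w i)

theorem foxOp_mul (v w : FreeGroup ι) :
    ψ.foxOp t (v * w) = ψ.foxOp t v + ψ.foxOp t w ∘L ψ.right (FreeGroup.lift t v) := by
  classical
  have h : ∀ w, ψ.foxOp t w = ψ.pathOp t w.toWord := fun w => by
    unfold foxOp pathOp foxChain
    congr!
  rw [h, h, h, FreeGroup.toWord_mul, ← ψ.pathOp_red t FreeGroup.reduce.red, pathOp_append,
    FreeGroup.mk_toWord]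

theorem foxOp_of (i : ι) : ψ.foxOp t (FreeGroup.of i) = ψ.incl i := by
  classical
  have h : ψ.foxOp t (FreeGroup.of i) = ψ.pathOp t (FreeGroup.of i).toWord := by
    unfold foxOp pathOp foxChain
    congr!
  rw [h, FreeGroup.toWord_of, pathOp_cons_true, pathOp_nil, zero_comp, add_zero]

theorem foxOp_one : ψ.foxOp t 1 = 0 := by
  have h := ψ.foxOp_mul t 1 1
  rwa [mul_one, _root_.map_one, right_one, comp_id, left_eq_add] at h

theorem intertwines_foxOp (w : FreeGroup ι) : Intertwines ψ.left ψ.leftPow (ψ.foxOp t w) :=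
  ψ.intertwines_opPi fun _ => ψ.intertwines_rightMul _

theorem intertwines_boundaryOne : Intertwines ψ.leftPow ψ.left (ψ.boundaryOne t) :=
  Intertwines.sum fun i _ => (ψ.intertwines_rightMul _).comp (ψ.intertwines_proj i)

theorem boundaryOne_incl (i : ι) :
    ψ.boundaryOne t ∘L ψ.incl i = ψ.right (t i) - ContinuousLinearMap.id ℂ _ := by
  classical
  ext x
  simp only [boundaryOne, comp_apply, sum_apply]
  rw [Finset.sum_eq_single i]
  · rw [PiLp.proj_apply, incl_apply, if_pos rfl, rightMul_sub, rightMul_one, rightMul_single,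
      one_smul]
  · intro j _ hj
    rw [PiLp.proj_apply, incl_apply, if_neg hj, map_zero]
  · simp

/-- The fundamental formula of Fox calculus. -/
theorem boundaryOne_foxOp (w : FreeGroup ι) :
    ψ.boundaryOne t ∘L ψ.foxOp t w =
      ψ.right (FreeGroup.lift t w) - ContinuousLinearMap.id ℂ _ := by
  have hmul : ∀ v w x, ψ.foxOp t (v * w) x =
      ψ.foxOp t v x + ψ.foxOp t w (ψ.right (FreeGroup.lift t v) x) := fun v w x =>
    congrArg (fun f => f x) (ψ.foxOp_mul t v w)
  have hr : ∀ g h x, ψ.right (g * h) x = ψ.right h (ψ.right g x) := fun g h x =>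
    congrArg (fun f => f x) (ψ.right_mul g h)
  have h1 : ∀ x, ψ.right 1 x = x := fun x => congrArg (fun f => f x) ψ.right_one
  have hf1 : ∀ x, ψ.foxOp t 1 x = 0 := fun x => congrArg (fun f => f x) (ψ.foxOp_one t)
  suffices h : ∀ x, ψ.boundaryOne t (ψ.foxOp t w x) = ψ.right (FreeGroup.lift t w) x - x from
    ContinuousLinearMap.ext h
  induction w using FreeGroup.induction_on with
  | C1 => intro x; rw [hf1, map_zero, _root_.map_one, h1, sub_self]
  | of i =>
    intro x
    rw [foxOp_of, FreeGroup.lift_apply_of]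
    exact congrArg (fun f => f x) (ψ.boundaryOne_incl t i)
  | inv_of i h =>
    intro x
    have h2 := hmul (FreeGroup.of i) (FreeGroup.of i)⁻¹
      (ψ.right (FreeGroup.lift t (FreeGroup.of i))⁻¹ x)
    rw [mul_inv_cancel, hf1, ← hr, inv_mul_cancel, h1] at h2
    rw [eq_neg_of_add_eq_zero_right h2.symm, map_neg, h, ← hr, inv_mul_cancel, h1, map_inv, neg_sub]
  | mul v w hv hw =>
    intro x
    rw [hmul, map_add, hv, hw, map_mul, hr, add_comm, sub_add_sub_cancel]

/-- The evaluation of the cocycles of `t` at a word. -/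
noncomputable abbrev eval (w : FreeGroup ι) : ψ.HilbPow ι →L[ℂ] ψ.Hilb := adjoint (ψ.foxOp t w)

/-- This is the adjoint of the Fox product rule: the cocycle identity for the left action of g by
right translation by g⁻¹. -/
theorem eval_mul (v w : FreeGroup ι) (x : ψ.HilbPow ι) :
    ψ.eval t (v * w) x = ψ.eval t v x + ψ.right (FreeGroup.lift t v)⁻¹ (ψ.eval t w x) := by
  rw [eval, foxOp_mul, map_add, adjoint_comp, adjoint_right]
  rfl

theorem eval_of (i : ι) (x : ψ.HilbPow ι) : ψ.eval t (FreeGroup.of i) x = x i := by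
  refine ext_inner_left ℂ fun z => ?_
  rw [adjoint_inner_right, foxOp_of, inner_incl]

theorem eval_one (x : ψ.HilbPow ι) : ψ.eval t 1 x = 0 := by
  rw [eval, foxOp_one, map_zero]; rfl

/-- Thus the orthogonal complement of im ∂₂ consists of the values on generators that extend to
cocycles of G. -/
theorem mem_orthogonal_range_boundaryTwo (x : ψ.HilbPow ι) :
    x ∈ (LinearMap.range (ψ.boundaryTwo t))ᗮ ↔
      ∀ r ∈ (FreeGroup.lift t).ker, ψ.eval t r x = 0 := by
  classical
  have hsingle : ∀ (r : (FreeGroup.lift t).ker) (y : ψ.Hilb),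
      ψ.boundaryTwo t (Finsupp.single r y) = ψ.foxOp t r y := by
    intro r y
    rw [boundaryTwo, Finsupp.lsum_single]
    rfl
  constructor
  · intro h r hr
    refine ext_inner_left ℂ fun z => ?_
    rw [adjoint_inner_right, inner_zero_right]
    exact (Submodule.mem_orthogonal _ _).1 h _ ⟨_, hsingle ⟨r, hr⟩ z⟩
  · rintro h
    rw [Submodule.mem_orthogonal]
    rintro _ ⟨y, rfl⟩
    induction y using Finsupp.induction_linear with
    | zero => rw [map_zero, inner_zero_left]
    | add a b ha hb => rw [map_add, inner_add_left, ha, hb, add_zero]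
    | single r y => rw [hsingle, ← adjoint_inner_right, h r r.2, inner_zero_right]

end GroupCharacter

/-! ### Vanishing of cocycles, and coboundaries -/

namespace GroupCharacter

variable {G : Type u} [Group G] (ψ : GroupCharacter G) {ι : Type w} [Fintype ι] {t : ι → G}

/-- A cocycle which vanishes on a generating set vanishes. -/
theorem eq_zero_of_eval_eq_zero {S : Set G} (hS : Subgroup.closure S = ⊤) {x : ψ.HilbPow ι}
    (hx : ∀ r ∈ (FreeGroup.lift t).ker, ψ.eval t r x = 0)
    (h : ∀ g ∈ S, ∃ w, FreeGroup.lift t w = g ∧ ψ.eval t w x = 0) : x = 0 := by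
  -- The zeros of a cocycle form a subgroup. It contains all relations, so it is everything once its
  -- image in G is.
  let W : Subgroup (FreeGroup ι) :=
    { carrier := {w | ψ.eval t w x = 0}
      one_mem' := ψ.eval_one t x
      mul_mem' := fun {v w} (hv : ψ.eval t v x = 0) (hw : ψ.eval t w x = 0) => by
        change ψ.eval t (v * w) x = 0
        rw [eval_mul, hv, hw, map_zero, add_zero]
      inv_mem' := fun {w} (hw : ψ.eval t w x = 0) => by
        change ψ.eval t w⁻¹ x = 0
        have h1 := ψ.eval_mul t w⁻¹ w x
        rwa [inv_mul_cancel, eval_one, hw, map_zero, add_zero, eq_comm] at h1 }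
  have hker : (FreeGroup.lift t).ker ≤ W := hx
  have hmap : W.map (FreeGroup.lift t) = ⊤ := by
    rw [eq_top_iff, ← hS, Subgroup.closure_le]
    intro g hg
    obtain ⟨w, hw, hw0⟩ := h g hg
    exact ⟨w, hw0, hw⟩
  ext i
  have hi : FreeGroup.lift t (FreeGroup.of i) ∈ W.map (FreeGroup.lift t) := by
    rw [hmap]; trivial
  obtain ⟨w, hw, hwi⟩ := hi
  have hmem : w⁻¹ * FreeGroup.of i ∈ (FreeGroup.lift t).ker := by
    rw [MonoidHom.mem_ker, map_mul, map_inv, hwi, inv_mul_cancel]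
  have h1 := W.mul_mem hw (hker hmem)
  rw [mul_inv_cancel_left] at h1
  rw [← ψ.eval_of t]
  exact h1

/-- A cocycle which vanishes at `a`, where right translation by `a` has no nonzero fixed vectors,
vanishes at every element commuting with `a`. -/
theorem eval_eq_zero_of_commute {x : ψ.HilbPow ι}
    (hx : ∀ r ∈ (FreeGroup.lift t).ker, ψ.eval t r x = 0) {v w : FreeGroup ι}
    (hvw : Commute (FreeGroup.lift t v) (FreeGroup.lift t w))
    (hfix : ∀ y, ψ.right (FreeGroup.lift t v) y = y → y = 0) (hv : ψ.eval t v x = 0) :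
    ψ.eval t w x = 0 := by
  -- The words `v * w` and `w * v` differ by a relation. Expanding both values leaves the value at
  -- `w` fixed by the inverse of `v`.
  have h1 : ψ.eval t (v * w) x = ψ.eval t (w * v) x := by
    have h2 := ψ.eval_mul t (v * w * (w * v)⁻¹) (w * v) x
    have h3 : v * w * (w * v)⁻¹ ∈ (FreeGroup.lift t).ker := by
      rw [MonoidHom.mem_ker, map_mul, map_inv, map_mul, map_mul, hvw.eq, mul_inv_cancel]
    rwa [inv_mul_cancel_right, hx _ h3, MonoidHom.mem_ker.1 h3, inv_one, right_one, zero_add] at h2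
  rw [eval_mul, eval_mul, hv, map_zero, zero_add, add_zero] at h1
  refine hfix _ ?_
  conv_lhs => rw [← h1]
  exact congrArg (fun f => f (ψ.eval t w x)) (ψ.right_comp_inv _)

/-- Dually, every coboundary, that is every vector in the image of ∂₁†, is a cocycle: by the
fundamental formula its value at a relation is zero. -/
theorem orthogonal_orthogonal_le_ker_boundaryOne :
    (LinearMap.range (ψ.boundaryTwo t))ᗮᗮ ≤ LinearMap.ker (ψ.boundaryOne t).toLinearMap := by
  intro x hx
  rw [LinearMap.mem_ker]
  refine ext_inner_left ℂ fun z => ?_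
  change inner ℂ z (ψ.boundaryOne t x) = inner ℂ z 0
  rw [← adjoint_inner_left, inner_zero_right]
  refine (Submodule.mem_orthogonal _ _).1 hx _ ?_
  rw [mem_orthogonal_range_boundaryTwo]
  intro r hr
  have h1 : ψ.eval t r (adjoint (ψ.boundaryOne t) z) =
      adjoint (ψ.boundaryOne t ∘L ψ.foxOp t r) z := by rw [adjoint_comp]; rfl
  rw [h1, boundaryOne_foxOp, MonoidHom.mem_ker.1 hr, right_one, sub_self, map_zero]
  rfl

/-- If the coboundary of y is zero, its value at `w` is too, so y is fixed by the value of `w` in G.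
Consequently ∂₁ has dense range. -/
theorem ker_adjoint_boundaryOne {w : FreeGroup ι}
    (hfix : ∀ y, ψ.right (FreeGroup.lift t w) y = y → y = 0) :
    LinearMap.ker (adjoint (ψ.boundaryOne t)).toLinearMap = ⊥ := by
  rw [LinearMap.ker_eq_bot']
  intro y hy
  have hy' : adjoint (ψ.boundaryOne t) y = 0 := hy
  have h1 : adjoint (ψ.boundaryOne t ∘L ψ.foxOp t w) y = 0 := by
    rw [adjoint_comp, comp_apply, hy', map_zero]
  have hid : adjoint (ContinuousLinearMap.id ℂ ψ.Hilb) = ContinuousLinearMap.id ℂ _ := by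
    rw [← right_one, adjoint_right, inv_one]
  rw [boundaryOne_foxOp, map_sub, adjoint_right, hid, sub_apply, sub_eq_zero] at h1
  refine hfix _ ?_
  conv_lhs => rw [← ContinuousLinearMap.id_apply (R₁ := ℂ) y, ← h1]
  exact congrArg (fun f => f y) (ψ.right_comp_inv _)

end GroupCharacter

/-! ### Projections onto nested subspaces -/

section Projections

variable {E : Type*} [NormedAddCommGroup E] [InnerProductSpace ℂ E]

theorem Submodule.hasOrthogonalProjection_of_isClosed [CompleteSpace E] {U : Submodule ℂ E}
    (hU : IsClosed (U : Set E)) : U.HasOrthogonalProjection :=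
  have : CompleteSpace U := hU.completeSpace_coe
  inferInstance

theorem Submodule.re_inner_self_starProjection_nonneg (U : Submodule ℂ E)
    [U.HasOrthogonalProjection] (x : E) : 0 ≤ (inner ℂ x (U.starProjection x)).re := by
  rw [← inner_conj_symm, Complex.conj_re]
  exact U.re_inner_starProjection_nonneg x

theorem Submodule.starProjection_eq_add {U V W : Submodule ℂ E} [U.HasOrthogonalProjection]
    [V.HasOrthogonalProjection] [W.HasOrthogonalProjection] (hV : V ≤ U) (hW : W = U ⊓ Vᗮ) (x : E) :
    U.starProjection x = V.starProjection x + W.starProjection x := by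
  have h1 : W.starProjection x = U.starProjection x - V.starProjection x := by
    refine Submodule.eq_starProjection_of_mem_of_inner_eq_zero ?_ fun w hw => ?_
    · rw [hW]
      refine ⟨U.sub_mem (U.starProjection_apply_mem x) (hV (V.starProjection_apply_mem x)),
        (Submodule.mem_orthogonal' _ _).2 fun v hv => ?_⟩
      have e1 := U.starProjection_inner_eq_zero x v (hV hv)
      have e2 := V.starProjection_inner_eq_zero x v hv
      rw [← sub_sub_sub_cancel_left _ _ x, inner_sub_left, e1, e2, sub_zero]
    · rw [hW] at hw
      have e1 := U.starProjection_inner_eq_zero x w hw.1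
      have e2 : inner ℂ (V.starProjection x) w = 0 :=
        (Submodule.mem_orthogonal _ _).1 hw.2 _ (V.starProjection_apply_mem x)
      rw [← sub_add, inner_add_left, e1, e2, add_zero]
  rw [h1, add_sub_cancel]

end Projections

/-! ### Dimension count for the first Betti number -/

namespace GroupCharacter

variable {G : Type u} [Group G] (ψ : GroupCharacter G) {ι : Type w} [Fintype ι] {t : ι → G}

theorem dim_nonneg (U : Submodule ℂ (ψ.HilbPow ι)) : 0 ≤ ψ.dim U :=
  Finset.sum_nonneg fun _ _ => U.topologicalClosure.re_inner_self_starProjection_nonneg _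

theorem dim_eq_add {U V W : Submodule ℂ (ψ.HilbPow ι)} (hU : IsClosed (U : Set (ψ.HilbPow ι)))
    (hV : IsClosed (V : Set (ψ.HilbPow ι))) (hW : IsClosed (W : Set (ψ.HilbPow ι)))
    (hVU : V ≤ U) (hWUV : W = U ⊓ Vᗮ) : ψ.dim U = ψ.dim V + ψ.dim W := by
  have := Submodule.hasOrthogonalProjection_of_isClosed hU
  have := Submodule.hasOrthogonalProjection_of_isClosed hV
  have := Submodule.hasOrthogonalProjection_of_isClosed hW
  rw [ψ.dim_eq_of_isClosed _ hU, ψ.dim_eq_of_isClosed _ hV, ψ.dim_eq_of_isClosed _ hW,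
    ← Finset.sum_add_distrib]
  refine Finset.sum_congr rfl fun i _ => ?_
  rw [Submodule.starProjection_eq_add hVU hWUV, inner_add_right, Complex.add_re]

/-- A closed invariant subspace which admits an injective equivariant map to `ℓ^ψ(G)` has
codimension at least `|ι| - 1`. -/
theorem card_sub_one_le_dim_orthogonal {Z : Submodule ℂ (ψ.HilbPow ι)} [Z.HasOrthogonalProjection]
    (hZ : ∀ g, ∀ x ∈ Z, ψ.leftPow g x ∈ Z) {T : ψ.HilbPow ι →L[ℂ] ψ.Hilb}
    (hT : Intertwines ψ.leftPow ψ.left T) (hinj : ∀ x ∈ Z, T x = 0 → x = 0) :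
    (Fintype.card ι : ℝ) - 1 ≤ ψ.dim Zᗮ := by
  have hP : Intertwines ψ.leftPow ψ.leftPow Z.starProjection := fun g x =>
    Z.starProjection_comm_of_invariant _ (hZ g)
      (fun x hx => by rw [adjoint_leftPow]; exact hZ _ x hx) x
  -- Composing with the projection turns injectivity of `T` on `Z` into a kernel equal to `Zᗮ`, to
  -- which the index formula applies.
  have hker : LinearMap.ker (T ∘L Z.starProjection).toLinearMap = Zᗮ := by
    ext x
    rw [LinearMap.mem_ker, ← Submodule.starProjection_apply_eq_zero_iff]
    change T (Z.starProjection x) = 0 ↔ _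
    refine ⟨fun h => hinj _ (Z.starProjection_apply_mem x) h, fun h => ?_⟩
    rw [h, map_zero]
  rw [← hker, dim_ker _ (hT.comp hP)]
  exact le_add_of_nonneg_right (Submodule.re_inner_self_starProjection_nonneg _ _)

/-- If no nonzero vector is fixed by right translation by the value of `w` and each cocycle is
determined by its value at `w`, then the first Betti number vanishes. -/
theorem bettiOne_eq_zero {w : FreeGroup ι}
    (hfix : ∀ y, ψ.right (FreeGroup.lift t w) y = y → y = 0)
    (hinj : ∀ x : ψ.HilbPow ι, (∀ r ∈ (FreeGroup.lift t).ker, ψ.eval t r x = 0) →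
      ψ.eval t w x = 0 → x = 0) : ψ.bettiOne t = 0 := by
  have hZmem := ψ.mem_orthogonal_range_boundaryTwo t
  have hle := ψ.orthogonal_orthogonal_le_ker_boundaryOne (t := t)
  have hZclosed := Submodule.isClosed_orthogonal (LinearMap.range (ψ.boundaryTwo t))
  have hUclosed : IsClosed (LinearMap.ker (ψ.boundaryOne t).toLinearMap : Set (ψ.HilbPow ι)) :=
    (ψ.boundaryOne t).isClosed_ker
  refine le_antisymm ?_ (ψ.dim_nonneg _)
  unfold bettiOne
  generalize (LinearMap.range (ψ.boundaryTwo t))ᗮ = Z at *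
  have := Submodule.hasOrthogonalProjection_of_isClosed hZclosed
  have heval : ∀ v, Intertwines ψ.leftPow ψ.left (ψ.eval t v) := fun v =>
    (ψ.intertwines_foxOp t v).adjoint ψ.adjoint_left ψ.adjoint_leftPow
  have hZinv : ∀ g, ∀ x ∈ Z, ψ.leftPow g x ∈ Z := by
    intro g x hx
    rw [hZmem] at hx ⊢
    intro r hr
    rw [heval, hx r hr, map_zero]
  have h1 := ψ.card_sub_one_le_dim_orthogonal hZinv (heval w) fun x hx => hinj x ((hZmem x).1 hx)
  have h2 := dim_ker (ψ.boundaryOne t) (ψ.intertwines_boundaryOne t)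
  have hbot : (LinearMap.ker (adjoint (ψ.boundaryOne t)).toLinearMap).starProjection
      ψ.traceVec = 0 := by
    rw [Submodule.starProjection_apply_eq_zero_iff, ψ.ker_adjoint_boundaryOne hfix,
      Submodule.bot_orthogonal_eq_top]
    trivial
  rw [hbot, inner_zero_right, Complex.zero_re, add_zero] at h2
  -- Split ker ∂₁ into `Zᗮ`, of dimension at least n - 1, and ker ∂₁ ∩ `Z`; the whole has dimension
  -- exactly n - 1.
  have h3 := ψ.dim_eq_add hUclosed (Submodule.isClosed_orthogonal Z) (hUclosed.inter hZclosed)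
    hle (W := LinearMap.ker (ψ.boundaryOne t).toLinearMap ⊓ Z)
    (by rw [Submodule.orthogonal_orthogonal])
  linarith

end GroupCharacter

/-! ### Right-angled groups -/

theorem mainTheorem5 {G : Type u} [Group G] {I : Type v} (s : I → G)
    (hs : IsRightAngledGenerating s) (ψ : GroupCharacter G)
    (hψ : ∀ i, ψ.IsRegularOn (Subgroup.zpowers (s i)))
    {ι : Type w} [Fintype ι] (t : ι → G) (ht : Subgroup.closure (Set.range t) = ⊤) :
    ψ.bettiOne t = 0 := by
  obtain ⟨-, Γ, hΓ, π, hπ, hπs, hord⟩ := hs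
  have hsurj : Function.Surjective (FreeGroup.lift t) := by
    rw [← MonoidHom.range_eq_top, FreeGroup.range_lift_eq_closure, ht]
  choose W hW using fun i => hsurj (s i)
  have hgen : Subgroup.closure (Set.range s) = ⊤ := by
    have h1 : Set.range s = π '' Set.range PresentedGroup.of := by
      rw [← Set.range_comp]
      exact congrArg Set.range (funext fun i => (hπs i).symm)
    rw [h1, ← MonoidHom.map_closure, PresentedGroup.closure_range_of, ← MonoidHom.range_eq_map,
      MonoidHom.range_eq_top.2 hπ]
  have hcomm : ∀ i j, Γ.Adj i j → Commute (s i) (s j) := by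
    intro i j hij
    have h1 : (PresentedGroup.of i * PresentedGroup.of j * (PresentedGroup.of i)⁻¹ *
        (PresentedGroup.of j)⁻¹ : RightAngledArtin Γ) = 1 :=
      PresentedGroup.one_of_mem ⟨i, j, hij, rfl⟩
    have h2 := congrArg π h1
    simp only [map_mul, map_inv, map_one, hπs] at h2
    rw [mul_inv_eq_one, mul_inv_eq_iff_eq_mul] at h2
    exact h2
  have hfix : ∀ i y, ψ.right (FreeGroup.lift t (W i)) y = y → y = 0 := fun i y hy => by
    rw [hW] at hy
    exact ψ.eq_zero_of_right_eq (hord i) (hψ i) hy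
  obtain ⟨i₀⟩ := hΓ.nonempty
  refine ψ.bettiOne_eq_zero (w := W i₀) (hfix i₀) fun x hx h0 => ?_
  have hall : ∀ i, ψ.eval t (W i) x = 0 := by
    intro i
    -- Vanishing travels along a walk, edge by edge, back from its endpoint `i₀` to `i`.
    obtain ⟨p⟩ := hΓ.preconnected i i₀
    induction p with
    | nil => exact h0
    | cons h p ih =>
      refine ψ.eval_eq_zero_of_commute hx ?_ (hfix _) (ih h0)
      rw [hW, hW]
      exact (hcomm _ _ h).symm
  refine ψ.eq_zero_of_eval_eq_zero hgen hx ?_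
  rintro _ ⟨i, rfl⟩
  exact ⟨W i, hW i, hall i⟩
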